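/- Let $k\ge 1$. For $n\ge 1$ let $C_n(\mathbb{R}^k)$ be the space of ordered $n$-tuples $p=(p_1,\dots,p_n)$ of distinct points of $\mathbb{R}^k$. For distinct indices $i,j$ put $\pi_{ij}(p)=\frac{p_i-p_j}{\|p_i-p_j\|}\in S^{k-1}$, and for pairwise distinct indices $i,j,l$ put $r_{ijl}(p)=\frac{\|p_i-p_j\|}{\|p_i-p_l\|}\in[0,\infty]$. The compactified configuration space $C_n[\mathbb{R}^k]$ is the closure of the image of $C_n(\mathbb{R}^k)$ under $$\alpha_n=\iota\times(\pi_{ij})\times(r_{ijl})\colon C_n(\mathbb{R}^k)\to A_n[\mathbb{R}^k]=(\mathbb{R}^k)^n\times(S^{k-1})^{n(n-1)}\times[0,\infty]^{n(n-1)(n-2)},$$ where $\iota$ is the inclusion $C_n(\mathbb{R}^k)\subset(\mathbb{R}^k)^n$. It carries the smooth structure induced from $A_n[\mathbb{R}^k]$ (where $[0,\infty]$ is identified with $[0,1]$ by $r\mapsto r/(1+r)$): a map is smooth if it is locally the restriction of a smooth map in the surrounding coordinates. Let $\Delta=(p_0,\dots,p_k)$ be a non-degenerate $k$-simplex in $\mathbb{R}^k$,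 that is, an ordered $(k+1)$-tuple of affinely independent points, and let $\mathrm{Sim}(\Delta)$ be the set of all $q\in C_{k+1}(\mathbb{R}^k)$ with $r_{ijl}(q)=r_{ijl}(\Delta)$ for all pairwise distinct $i,j,l$. Let $\overline{\mathrm{Sim}}(\Delta)$ be the closure of $\alpha_{k+1}(\mathrm{Sim}(\Delta))$ in $C_{k+1}[\mathbb{R}^k]$. Then $\overline{\mathrm{Sim}}(\Delta)$ is a submanifold of $C_{k+1}[\mathbb{R}^k]$, of dimension $\frac{k(k-1)}{2}+1+k$: with $N=k(k+1)$, every point of $\overline{\mathrm{Sim}}(\Delta)$ has an open neighbourhood in $C_{k+1}[\mathbb{R}^k]$ with a diffeomorphism onto an open subset of some $\{y\in\mathbb{R}^N : y_i\ge 0 \text{ for } i\in J\}$, $J\subseteq\{1,\dots,N\}$, under which $\overline{\mathrm{Sim}}(\Delta)$ corresponds to the points with $y_i=0$ for all $i\in K$, for some $K\subseteq\{1,\dots,N\}$ disjoint from $J$ with $N-|K|=\frac{k(k-1)}{2}+1+k$. Moreover $\overline{\mathrm{Sim}}(\Delta)$ is diffeomorphic to $\mathrm{O}(k)\times[0,\infty)\times\mathbb{R}^k$.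 -/

import Mathlib

open scoped ContDiff ENNReal

noncomputable section

namespace SimplexConfig

/-! ### Smooth maps between subsets of normed spaces -/

section Smooth

variable {E F : Type*} [NormedAddCommGroup E] [NormedSpace ℝ E]
  [NormedAddCommGroup F] [NormedSpace ℝ F]

/-- A map between subsets of normed spaces is smooth if, near every point of its domain, it is the
restriction of a `C^∞` map defined on an open subset of the surrounding space. -/
def IsSmooth {X : Set E} {Y : Set F} (f : X → Y) : Prop :=
  ∀ x : X, ∃ U : Set E, IsOpen U ∧ (x : E) ∈ U ∧ ∃ g : E → F,
    ContDiffOn ℝ ∞ g U ∧ ∀ y : X, (y : E) ∈ U → (f y : F) = g y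

/-- A diffeomorphism between subsets of normed spaces: a bijection that is smooth in both
directions. -/
structure SetDiffeo (X : Set E) (Y : Set F) where
  toEquiv : X ≃ Y
  smooth_toFun : IsSmooth toEquiv
  smooth_invFun : IsSmooth toEquiv.symm

/-- The model `{y ∈ ℝ^N | y i ≥ 0 for i ∈ J}` of an `N`-manifold with boundary and corners. -/
def quadrant (N : ℕ) (J : Finset (Fin N)) : Set (Fin N → ℝ) :=
  {y | ∀ i ∈ J, 0 ≤ y i}

/-- `S ⊆ X` is a `d`-dimensional submanifold (with boundary and corners) of the `N`-dimensional
manifold with boundary and corners `X`: every point of `S` has a neighbourhood in `X` that is the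
domain of a chart of `X`, that is, of a diffeomorphism `e` onto a relatively open subset of a model
`quadrant N J`, in which `S` is cut out by the vanishing of `N - d` of the coordinates that are not
constrained to be nonnegative. In particular, the boundary of `S` is the part of `S` in
the boundary of `X`, and `S` meets the boundary of `X` transversally. -/
def IsSubmanifold (N d : ℕ) (X S : Set E) : Prop :=
  S ⊆ X ∧ ∀ x ∈ S, ∃ J K : Finset (Fin N), Disjoint J K ∧ K.card + d = N ∧
    ∃ U : Set E, IsOpen U ∧ x ∈ U ∧ ∃ W : Set (Fin N → ℝ), IsOpen W ∧
      ∃ e : SetDiffeo (X ∩ U) (quadrant N J ∩ W),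
        ∀ z : (X ∩ U : Set E), (z : E) ∈ S ↔ ∀ i ∈ K, (e.toEquiv z : Fin N → ℝ) i = 0

end Smooth

/-! ### Configuration spaces of points in `ℝ^k` and their compactifications -/

/-- Euclidean space `ℝ^k`. -/
abbrev Euc (k : ℕ) : Type := EuclideanSpace ℝ (Fin k)

/-- Ordered pairs of distinct indices. -/
abbrev Pairs (n : ℕ) : Type := {p : Fin n × Fin n // p.1 ≠ p.2}

/-- Ordered triples `(i, j, l)` of pairwise distinct indices. -/
abbrev Triples (n : ℕ) : Type :=
  {t : Fin n × Fin n × Fin n // t.1 ≠ t.2.1 ∧ t.2.1 ≠ t.2.2 ∧ t.1 ≠ t.2.2}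

/-- The open configuration space `C_n(ℝ^k)` of `n` distinct ordered points. -/
abbrev Config (k n : ℕ) : Type := {p : Fin n → Euc k // Function.Injective p}

/-- The direction `π_{ij}(p) = (p_i - p_j) / ‖p_i - p_j‖`, a point of the unit sphere. -/
def direction {k n : ℕ} (p : Config k n) (a : Pairs n) : Metric.sphere (0 : Euc k) 1 :=
  ⟨‖p.1 a.1.1 - p.1 a.1.2‖⁻¹ • (p.1 a.1.1 - p.1 a.1.2), by
    have h : p.1 a.1.1 - p.1 a.1.2 ≠ 0 := sub_ne_zero.2 fun h => a.2 (p.2 h)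
    rw [mem_sphere_zero_iff_norm, norm_smul, norm_inv, norm_norm,
      inv_mul_cancel₀ (norm_ne_zero_iff.2 h)]⟩

/-- The ratio of distances `r_{ijl}(p) = ‖p_i - p_j‖ / ‖p_i - p_l‖`. -/
def ratio {k n : ℕ} (p : Config k n) (t : Triples n) : ℝ≥0∞ :=
  ENNReal.ofReal (‖p.1 t.1.1 - p.1 t.1.2.1‖ / ‖p.1 t.1.1 - p.1 t.1.2.2‖)

/-- `A_n[ℝ^k] = (ℝ^k)^n × (S^{k-1})^{n(n-1)} × [0,∞]^{n(n-1)(n-2)}`. -/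
abbrev Ambient (k n : ℕ) : Type :=
  (Fin n → Euc k) × (Pairs n → Metric.sphere (0 : Euc k) 1) × (Triples n → ℝ≥0∞)

/-- The map `α_n = ι × (π_{ij}) × (r_{ijl}) : C_n(ℝ^k) → A_n[ℝ^k]`. -/
def alpha {k n : ℕ} (p : Config k n) : Ambient k n :=
  (p.1, direction p, ratio p)

/-- The compactified configuration space `C_n[ℝ^k]`, the closure of `α_n(C_n(ℝ^k))` in
`A_n[ℝ^k]`. -/
def compactConfig (k n : ℕ) : Set (Ambient k n) :=
  closure (Set.range alpha)

/-- The vector space that contains `A_n[ℝ^k]` as a product of submanifolds. -/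
abbrev AmbientVec (k n : ℕ) : Type :=
  (Fin n → Euc k) × (Pairs n → Euc k) × (Triples n → ℝ)

/-- The embedding of `A_n[ℝ^k]` into a vector space that gives `A_n[ℝ^k]` its smooth structure: the
sphere is included in `ℝ^k`, and `[0,∞]` is identified with `[0,1]` by `r ↦ (r⁻¹ + 1)⁻¹ = r/(1+r)`.
This is a diffeomorphism for the usual smooth structure of `[0,∞]`, in which `r` is a coordinate on
`[0,∞)` and `1/r` is a coordinate on `(0,∞]`. -/
def ambientCoord {k n : ℕ} (z : Ambient k n) : AmbientVec k n :=
  (z.1, fun a => (z.2.1 a : Euc k), fun t => (ENNReal.orderIsoUnitIntervalBirational (z.2.2 t) : ℝ))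

/-! ### Simplices similar to a given one -/

/-- A non-degenerate simplex, with its ordered vertices, as a point of `C_{k+1}(ℝ^k)`. -/
def simplexConfig {k : ℕ} (Δ : Affine.Simplex ℝ (Euc k) k) : Config k (k + 1) :=
  ⟨Δ.points, Δ.independent.injective⟩

/-- `Sim(Δ)`, the set of configurations with the same ratios of distances as `Δ`. -/
def Sim {k : ℕ} (Δ : Affine.Simplex ℝ (Euc k) k) : Set (Config k (k + 1)) :=
  {q | ∀ t : Triples (k + 1), ratio q t = ratio (simplexConfig Δ) t}

/-- The closure of `Sim(Δ)` in `C_{k+1}[ℝ^k]`. (As `C_{k+1}[ℝ^k]` is closed in `A_{k+1}[ℝ^k]`, it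
is the closure in `A_{k+1}[ℝ^k]`.) -/
def simClosure {k : ℕ} (Δ : Affine.Simplex ℝ (Euc k) k) : Set (Ambient k (k + 1)) :=
  closure (alpha '' Sim Δ)

/-- The orthogonal group `O(k)` as a subset of the vector space of `k × k` matrices. -/
def orthogonalMatrices (k : ℕ) : Set (Fin k → Fin k → ℝ) :=
  {A | Matrix.of A ∈ Matrix.orthogonalGroup (Fin k) ℝ}

end SimplexConfig

end

open scoped ContDiff ENNReal

noncomputable section

namespace SimplexConfig

/-! ### Building smooth diffeomorphisms and local inverses. -/

section Smooth

variable {E F : Type*} [NormedAddCommGroup E] [NormedSpace ℝ E]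
  [NormedAddCommGroup F] [NormedSpace ℝ F]

/-! Where no ratio of distances is `0` or `∞`, points can only collide all together. There the
compactified space consists of triples `(v, t, B)`: base point `v`, scale `t ≥ 0`, and a frame `B`
of edge vectors at the first point, normalized by `‖B 0‖ = 1` (`eq_model_of_mem`). For `t > 0` the
triple is the configuration `v + t • cone B`; for `t = 0` it is a total collision that remembers the
shape `B`. All three data are smooth in the surrounding coordinates.

For normalized frames the ratios and the Gram matrix determine each other (`model_ratios_eq_iff`).
So the closure of `Sim(Δ)` is the locus where `B` has the Gram matrix of the frame of `Δ`, with `v`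
and `t ≥ 0` free (`mem_simClosure_iff_inner`). Frames with a given nondegenerate Gram matrix form
one free orbit of `O(k)`, which gives the global diffeomorphism. For the submanifold property, Gram
entries on and below the diagonal extend to local coordinates on frames
(`exists_gramCoord_local_inverse`). In them the closure is a coordinate slice, transverse to the
boundary `t = 0`. -/

/-- Two maps, smooth on open neighbourhoods of `X` and `Y`, that restrict to mutually inverse maps
between `X` and `Y`, define a diffeomorphism. -/
def SetDiffeo.ofMaps {X : Set E} {Y : Set F} (f : E → F) (g : F → E) {U : Set E} {V : Set F}
    (hU : IsOpen U) (hXU : X ⊆ U) (hf : ContDiffOn ℝ ∞ f U)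
    (hV : IsOpen V) (hYV : Y ⊆ V) (hg : ContDiffOn ℝ ∞ g V)
    (hfX : ∀ x ∈ X, f x ∈ Y) (hgY : ∀ y ∈ Y, g y ∈ X)
    (hgf : ∀ x ∈ X, g (f x) = x) (hfg : ∀ y ∈ Y, f (g y) = y) : SetDiffeo X Y where
  toEquiv :=
    { toFun := fun x => ⟨f x, hfX x x.2⟩
      invFun := fun y => ⟨g y, hgY y y.2⟩
      left_inv := fun x => Subtype.ext (hgf x x.2)
      right_inv := fun y => Subtype.ext (hfg y y.2) }
  smooth_toFun := fun x => ⟨U, hU, hXU x.2, f, hf, fun _ _ => rfl⟩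
  smooth_invFun := fun y => ⟨V, hV, hYV y.2, g, hg, fun _ _ => rfl⟩

/-- The inverse function theorem for analytic maps, with a smooth inverse on an open set. -/
theorem exists_smooth_local_inverse [CompleteSpace E] {f : E → F} (hf : ContDiff ℝ ω f) {a : E}
    {f' : E ≃L[ℝ] F} (hf' : HasFDerivAt f (f' : E →L[ℝ] F) a) {O : Set E} (hO : IsOpen O)
    (ha : a ∈ O) :
    ∃ (P : Set E) (Q : Set F) (σ : F → E), IsOpen P ∧ IsOpen Q ∧ a ∈ P ∧ P ⊆ O ∧
      ContDiffOn ℝ ∞ σ Q ∧ (∀ x ∈ P, f x ∈ Q ∧ σ (f x) = x) ∧ ∀ y ∈ Q, σ y ∈ P ∧ f (σ y) = y := by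
  have hω : (ω : WithTop ℕ∞) ≠ 0 := by simp
  let e := hf.contDiffAt.toOpenPartialHomeomorph f hf' hω
  have hae : a ∈ e.source := hf.contDiffAt.mem_toOpenPartialHomeomorph_source hf' hω
  have hsymm : ContDiffAt ℝ ω e.symm (f a) := hf.contDiffAt.to_localInverse hf' hω
  -- Analyticity at a point spreads to a neighbourhood. Being `C^∞` at a point does not, since the
  -- neighbourhood may shrink with the order; hence the analytic hypothesis.
  obtain ⟨Q₀, hQ₀, hQ₀o, haQ₀⟩ := eventually_nhds_iff.1 (hsymm.eventually (by simp))
  let e₁ := (e.restr O).symm.restr Q₀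
  have hs : ∀ x, x ∈ e₁.target ↔ x ∈ e.source ∧ x ∈ O ∧ f x ∈ Q₀ := by
    intro x
    simp only [e₁, OpenPartialHomeomorph.restr_target, OpenPartialHomeomorph.symm_target,
      OpenPartialHomeomorph.restr_source, hO.interior_eq, hQ₀o.interior_eq,
      OpenPartialHomeomorph.symm_symm, Set.mem_inter_iff, Set.mem_preimage, and_assoc]
    rfl
  refine ⟨e₁.target, e₁.source, e.symm, e₁.open_target, e₁.open_source, (hs a).2 ⟨hae, ha, haQ₀⟩,
    fun x hx => ((hs x).1 hx).2.1, fun y hy => ?_, fun x hx => ⟨e₁.map_target hx, ?_⟩,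
    fun y hy => ⟨e₁.map_source hy, e₁.left_inv hy⟩⟩
  · have : y ∈ Q₀ := by
      have := hy
      simp only [e₁, OpenPartialHomeomorph.restr_source, hQ₀o.interior_eq] at this
      exact this.2
    exact ((hQ₀ y this).of_le le_top).contDiffWithinAt
  · exact e₁.right_inv hx

end Smooth

/-! ### Gram matrices as local coordinates on frames. -/

section Gram

variable {k : ℕ}

/-- Coordinates on families of `k` vectors near a basis `B₀`: the entries of the Gram matrix on and
below the diagonal, relative to those of `B₀`, and above the diagonal the skew part of the matrix
of inner products with `B₀`. -/
def gramCoord (B₀ B : Fin k → Euc k) : Fin k → Fin k → ℝ := fun i j =>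
  if j ≤ i then inner ℝ (B i) (B j) - inner ℝ (B₀ i) (B₀ j)
  else inner ℝ (B i) (B₀ j) - inner ℝ (B₀ i) (B j)

/-- The derivative of `gramCoord B₀` at `B₀`. -/
def gramCoordDeriv (B₀ : Fin k → Euc k) : (Fin k → Euc k) →L[ℝ] (Fin k → Fin k → ℝ) :=
  ContinuousLinearMap.pi fun i => ContinuousLinearMap.pi fun j =>
    if j ≤ i then (innerSL ℝ (B₀ j)).comp (ContinuousLinearMap.proj i) +
      (innerSL ℝ (B₀ i)).comp (ContinuousLinearMap.proj j)
    else (innerSL ℝ (B₀ j)).comp (ContinuousLinearMap.proj i) -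
      (innerSL ℝ (B₀ i)).comp (ContinuousLinearMap.proj j)

theorem contDiff_gramCoord (B₀ : Fin k → Euc k) {n : WithTop ℕ∞} :
    ContDiff ℝ n (gramCoord B₀) := by
  refine contDiff_pi.2 fun i => contDiff_pi.2 fun j => ?_
  unfold gramCoord
  split_ifs
  · exact ((contDiff_apply ℝ (Euc k) i).inner ℝ (contDiff_apply ℝ (Euc k) j)).sub contDiff_const
  · exact ((contDiff_apply ℝ (Euc k) i).inner ℝ contDiff_const).sub
      (contDiff_const.inner ℝ (contDiff_apply ℝ (Euc k) j))

theorem hasFDerivAt_gramCoord (B₀ : Fin k → Euc k) :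
    HasFDerivAt (gramCoord B₀) (gramCoordDeriv B₀) B₀ := by
  refine hasFDerivAt_pi.2 fun i => hasFDerivAt_pi.2 fun j => ?_
  have hp : ∀ i : Fin k, HasFDerivAt (fun B : Fin k → Euc k => B i)
      (ContinuousLinearMap.proj i : (Fin k → Euc k) →L[ℝ] Euc k) B₀ := fun i =>
    (ContinuousLinearMap.proj (R := ℝ) (φ := fun _ : Fin k => Euc k) i).hasFDerivAt
  unfold gramCoord
  split_ifs with h
  · convert! ((hp i).inner ℝ (hp j)).sub_const (inner ℝ (B₀ i) (B₀ j)) using 1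
    ext H
    simp [real_inner_comm, add_comm]
  · convert! ((hp i).inner ℝ (hasFDerivAt_const (B₀ j) B₀)).sub
      ((hasFDerivAt_const (B₀ i) B₀).inner ℝ (hp j)) using 1
    ext H
    simp [real_inner_comm]

/-- For `H` in the kernel, the lower entries make the matrix of products `⟨B₀ j, H i⟩` skew and the
upper ones make it symmetric, so it vanishes. Each `H i` is then orthogonal to a basis. -/
theorem gramCoordDeriv_injective {B₀ : Fin k → Euc k} (hB₀ : LinearIndependent ℝ B₀) :
    Function.Injective (gramCoordDeriv B₀) := by
  refine (injective_iff_map_eq_zero _).2 fun H hH => ?_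
  have hle : ∀ i j, j ≤ i → inner ℝ (B₀ j) (H i) + inner ℝ (B₀ i) (H j) = 0 := fun i j h => by
    simpa [gramCoordDeriv, h] using congrFun (congrFun hH i) j
  have hlt : ∀ i j, i < j → inner ℝ (B₀ j) (H i) - inner ℝ (B₀ i) (H j) = 0 := fun i j h => by
    simpa [gramCoordDeriv, h.not_ge] using congrFun (congrFun hH i) j
  have hz : ∀ i j, inner ℝ (B₀ j) (H i) = 0 := by
    intro i j
    rcases lt_trichotomy i j with h | h | h
    · linarith [hle j i h.le, hlt i j h]
    · subst h
      linarith [hle i i le_rfl]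
    · linarith [hle i j h.le, hlt j i h]
  have hspan : Submodule.span ℝ (Set.range B₀) = ⊤ :=
    hB₀.span_eq_top_of_card_eq_finrank' (by simp)
  funext i
  have hmem : H i ∈ Submodule.span ℝ (Set.range B₀) := hspan ▸ Submodule.mem_top
  refine inner_self_eq_zero (𝕜 := ℝ).1 ?_
  refine Submodule.span_induction (p := fun x _ => inner ℝ x (H i) = 0) ?_ ?_ ?_ ?_ hmem
  · rintro _ ⟨j, rfl⟩
    exact hz i j
  · simp
  · intro x y _ _ hx hy
    rw [inner_add_left, hx, hy, add_zero]
  · intro c x _ hx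
    rw [real_inner_smul_left, hx, mul_zero]

/-- Both spaces have dimension `k²`, so the injective derivative is an isomorphism and the inverse
function theorem applies. -/
theorem exists_gramCoord_local_inverse {B₀ : Fin k → Euc k} (hB₀ : LinearIndependent ℝ B₀)
    {O : Set (Fin k → Euc k)} (hO : IsOpen O) (hBO : B₀ ∈ O) :
    ∃ (P : Set (Fin k → Euc k)) (Q : Set (Fin k → Fin k → ℝ))
      (σ : (Fin k → Fin k → ℝ) → Fin k → Euc k), IsOpen P ∧ IsOpen Q ∧ B₀ ∈ P ∧ P ⊆ O ∧
      ContDiffOn ℝ ∞ σ Q ∧ (∀ x ∈ P, gramCoord B₀ x ∈ Q ∧ σ (gramCoord B₀ x) = x) ∧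
      ∀ y ∈ Q, σ y ∈ P ∧ gramCoord B₀ (σ y) = y := by
  have hrank : Module.finrank ℝ (Fin k → Euc k) = Module.finrank ℝ (Fin k → Fin k → ℝ) := by
    simp [Module.finrank_pi_fintype]
  let L := (LinearEquiv.ofInjectiveOfFinrankEq (gramCoordDeriv B₀).toLinearMap
    (gramCoordDeriv_injective hB₀) hrank).toContinuousLinearEquiv
  refine exists_smooth_local_inverse (contDiff_gramCoord B₀) (f' := L) ?_ hO hBO
  convert! hasFDerivAt_gramCoord B₀ using 1

/-- A family with the Gram matrix of a linearly independent one is linearly independent. -/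
theorem linearIndependent_of_inner_eq {B B' : Fin k → Euc k} (hB : LinearIndependent ℝ B)
    (h : ∀ i j, inner ℝ (B' i) (B' j) = inner ℝ (B i) (B j)) : LinearIndependent ℝ B' := by
  rw [← Matrix.posDef_gram_iff_linearIndependent (𝕜 := ℝ)] at hB ⊢
  convert hB using 1
  ext i j
  simpa [Matrix.gram] using h i j

theorem card_lowerTriangle (k : ℕ) :
    (Finset.univ.filter fun p : Fin k × Fin k => p.2 ≤ p.1).card = (k + 1).choose 2 := by
  rw [Finset.card_filter, Fintype.sum_prod_type]
  simp only [← Finset.card_filter, Finset.filter_ge_eq_Iic, Fin.card_Iic]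
  rw [Fin.sum_univ_eq_sum_range fun i => i + 1]
  induction k with
  | zero => rfl
  | succ k ih =>
    rw [Finset.sum_range_succ, ih, Nat.choose_succ_succ' (k + 1) 1, Nat.choose_one_right, add_comm]

end Gram

/-! ### The collision chart of the compactified configuration space -/

section Model

variable {k n : ℕ}

/-- The point of the compactified configuration space, in the surrounding coordinates, that is
given by the configuration `v + t • u`, with the directions and ratios of `u` also for `t = 0`. -/
def model (v : Euc k) (t : ℝ) (u : Fin n → Euc k) : AmbientVec k n :=
  (fun i => v + t • u i, fun a => ‖u a.1.1 - u a.1.2‖⁻¹ • (u a.1.1 - u a.1.2),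
    fun s => ‖u s.1.1 - u s.1.2.1‖ / (‖u s.1.1 - u s.1.2.1‖ + ‖u s.1.1 - u s.1.2.2‖))

/-- The point of `A_n[ℝ^k]` whose coordinates are `model v t u`. -/
def modelPoint (v : Euc k) (t : ℝ) (u : Config k n) : Ambient k n :=
  (fun i => v + t • u.1 i, direction u, ratio u)

theorem orderIsoUnitIntervalBirational_ofReal_div {a b : ℝ} (ha : 0 < a) (hb : 0 < b) :
    (ENNReal.orderIsoUnitIntervalBirational (ENNReal.ofReal (a / b)) : ℝ) = a / (a + b) := by
  have h : 0 < a / b := div_pos ha hb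
  rw [ENNReal.orderIsoUnitIntervalBirational_apply_coe, ENNReal.toReal_inv,
    ENNReal.toReal_add (by simpa using h) (by simp), ENNReal.toReal_inv,
    ENNReal.toReal_ofReal h.le, ENNReal.toReal_one]
  field_simp
  ring

theorem Config.norm_sub_pos (u : Config k n) {i j : Fin n} (h : i ≠ j) :
    0 < ‖u.1 i - u.1 j‖ :=
  norm_pos_iff.2 (sub_ne_zero.2 fun e => h (u.2 e))

theorem ambientCoord_modelPoint (v : Euc k) (t : ℝ) (u : Config k n) :
    ambientCoord (modelPoint v t u) = model v t u.1 := by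
  refine Prod.ext rfl (Prod.ext rfl (funext fun s => ?_))
  exact orderIsoUnitIntervalBirational_ofReal_div (u.norm_sub_pos s.2.1) (u.norm_sub_pos s.2.2.2)

/-- The configuration `v + t • u`. -/
def Config.affine (v : Euc k) {t : ℝ} (ht : 0 < t) (u : Config k n) : Config k n :=
  ⟨fun i => v + t • u.1 i, fun _ _ h =>
    u.2 (smul_right_injective _ ht.ne' (add_left_cancel h))⟩

theorem Config.affine_sub (v : Euc k) {t : ℝ} (ht : 0 < t) (u : Config k n) (i j : Fin n) :
    (u.affine v ht).1 i - (u.affine v ht).1 j = t • (u.1 i - u.1 j) := by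
  simp [Config.affine, smul_sub]

theorem ratio_affine (v : Euc k) {t : ℝ} (ht : 0 < t) (u : Config k n) :
    ratio (u.affine v ht) = ratio u := by
  funext s
  simp only [ratio, Config.affine_sub, norm_smul]
  rw [mul_div_mul_left _ _ (norm_ne_zero_iff.2 ht.ne')]

theorem direction_affine (v : Euc k) {t : ℝ} (ht : 0 < t) (u : Config k n) :
    direction (u.affine v ht) = direction u := by
  funext a
  refine Subtype.ext ?_
  simp only [direction, Config.affine_sub, norm_smul, smul_smul, Real.norm_of_nonneg ht.le]
  congr 1
  field_simp

theorem alpha_affine (v : Euc k) {t : ℝ} (ht : 0 < t) (u : Config k n) :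
    alpha (u.affine v ht) = modelPoint v t u :=
  Prod.ext rfl (Prod.ext (direction_affine v ht u) (ratio_affine v ht u))

/-- As `t` tends to `0` from above only the positions move, while directions and ratios stay
constant. A collision point is thus a limit of rescaled copies of `u`. -/
theorem modelPoint_mem_closure {A : Set (Config k n)} (v : Euc k) {t : ℝ} (ht : 0 ≤ t)
    (u : Config k n) (hA : ∀ (t : ℝ) (ht : 0 < t), u.affine v ht ∈ A) :
    modelPoint v t u ∈ closure (alpha '' A) := by
  have hc : Continuous fun t : ℝ => modelPoint v t u :=
    (continuous_pi fun i => continuous_const.add (continuous_id.smul continuous_const)).prodMk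
      continuous_const
  refine hc.continuousWithinAt.mem_closure (s := Set.Ioi 0) (by simpa using ht) fun t ht => ?_
  exact ⟨_, hA t ht, alpha_affine v ht u⟩

theorem model_mem_compactConfig (v : Euc k) {t : ℝ} (ht : 0 ≤ t) {u : Fin n → Euc k}
    (hu : Function.Injective u) : model v t u ∈ ambientCoord '' compactConfig k n := by
  refine ⟨modelPoint v t ⟨u, hu⟩, ?_, ambientCoord_modelPoint v t ⟨u, hu⟩⟩
  rw [compactConfig, ← Set.image_univ]
  exact modelPoint_mem_closure v ht _ fun _ _ => trivial

theorem model_mem_simClosure (Δ : Affine.Simplex ℝ (Euc k) k) (v : Euc k) {t : ℝ} (ht : 0 ≤ t)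
    {u : Config k (k + 1)} (hu : u ∈ Sim Δ) :
    model v t u.1 ∈ ambientCoord '' simClosure Δ := by
  refine ⟨modelPoint v t u, modelPoint_mem_closure v ht _ fun s hs i => ?_,
    ambientCoord_modelPoint v t u⟩
  rw [ratio_affine]
  exact hu i

/-- The points whose ratio coordinates all lie in `(0, 1)`, that is, whose ratios of distances are
neither `0` nor `∞`. -/
def finiteRatios (k n : ℕ) : Set (AmbientVec k n) :=
  {z | ∀ s, 0 < z.2.2 s ∧ z.2.2 s < 1}

theorem isOpen_finiteRatios : IsOpen (finiteRatios k n) := by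
  simp only [finiteRatios, Set.ofPred_forall, Set.ofPred_and]
  refine isOpen_iInter_of_finite fun s => ?_
  have hc : Continuous fun z : AmbientVec k n => z.2.2 s := by fun_prop
  exact (isOpen_lt continuous_const hc).inter (isOpen_lt hc continuous_const)

theorem model_mem_finiteRatios (v : Euc k) (t : ℝ) {u : Fin n → Euc k}
    (hu : Function.Injective u) : model v t u ∈ finiteRatios k n := by
  intro s
  have h₁ := Config.norm_sub_pos ⟨u, hu⟩ s.2.1
  have h₂ := Config.norm_sub_pos ⟨u, hu⟩ s.2.2.2
  refine ⟨div_pos h₁ (add_pos h₁ h₂), (div_lt_one (add_pos h₁ h₂)).2 ?_⟩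
  simpa using h₂

theorem contDiffOn_model : ContDiffOn ℝ ∞
    (fun x : Euc k × ℝ × (Fin n → Euc k) => model x.1 x.2.1 x.2.2)
    {x | Function.Injective x.2.2} := by
  intro x hx
  refine ContDiffAt.contDiffWithinAt ?_
  have hu : ∀ i : Fin n, ContDiffAt ℝ ∞ (fun x : Euc k × ℝ × (Fin n → Euc k) => x.2.2 i) x := by
    intro i
    fun_prop
  have hn : ∀ i j : Fin n, i ≠ j →
      ContDiffAt ℝ ∞ (fun x : Euc k × ℝ × (Fin n → Euc k) => ‖x.2.2 i - x.2.2 j‖) x :=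
    fun i j h => ((hu i).sub (hu j)).norm ℝ (sub_ne_zero.2 fun e => h (hx e))
  have hp : ∀ i j : Fin n, i ≠ j → 0 < ‖x.2.2 i - x.2.2 j‖ := fun i j h =>
    Config.norm_sub_pos ⟨x.2.2, hx⟩ h
  refine ContDiffAt.prodMk (contDiffAt_pi.2 fun i => ?_)
    (ContDiffAt.prodMk (contDiffAt_pi.2 fun a => ?_) (contDiffAt_pi.2 fun s => ?_))
  · fun_prop
  · exact ((hn _ _ a.2).inv (hp _ _ a.2).ne').smul ((hu _).sub (hu _))
  · exact (hn _ _ s.2.1).div ((hn _ _ s.2.1).add (hn _ _ s.2.2.2))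
      (add_pos (hp _ _ s.2.1) (hp _ _ s.2.2.2)).ne'

end Model

/-! ### Recovering base point, scale and edge frame from the surrounding coordinates. -/

section Edges

variable {k : ℕ}

/-- The configuration with first point `0` and other points `B`. -/
def cone (B : Fin k → Euc k) : Fin (k + 1) → Euc k := Fin.cons 0 B

@[simp]
theorem cone_zero (B : Fin k → Euc k) : cone B 0 = 0 := rfl

@[simp]
theorem cone_succ (B : Fin k → Euc k) (i : Fin k) : cone B i.succ = B i := rfl

theorem contDiff_cone {m : WithTop ℕ∞} : ContDiff ℝ m (cone : (Fin k → Euc k) → _) := by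
  refine contDiff_pi.2 fun i => ?_
  refine Fin.cases ?_ (fun j => ?_) i
  · exact contDiff_const
  · exact contDiff_apply ℝ (Euc k) j

theorem isOpen_injective_cone : IsOpen {B : Fin k → Euc k | Function.Injective (cone B)} := by
  have : {B : Fin k → Euc k | Function.Injective (cone B)} =
      ⋂ a : Pairs (k + 1), {B | cone B a.1.1 ≠ cone B a.1.2} := by
    ext B
    simp only [Set.mem_ofPred_eq, Set.mem_iInter]
    exact ⟨fun h a e => a.2 (h e), fun h i j e => by_contra fun hij => h ⟨(i, j), hij⟩ e⟩
  rw [this]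
  have hc := (contDiff_cone (k := k) (m := 0)).continuous
  exact isOpen_iInter_of_finite fun a =>
    isOpen_ne_fun ((continuous_apply _).comp hc) ((continuous_apply _).comp hc)

theorem cone_injective_of_linearIndependent {B : Fin k → Euc k} (hB : LinearIndependent ℝ B) :
    Function.Injective (cone B) :=
  Fin.cons_injective_iff.2 ⟨fun ⟨i, hi⟩ => hB.ne_zero i hi, hB.injective⟩

theorem contDiffOn_model_cone : ContDiffOn ℝ ∞
    (fun x : Euc k × ℝ × (Fin k → Euc k) => model x.1 x.2.1 (cone x.2.2))
    {x | Function.Injective (cone x.2.2)} := by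
  refine contDiffOn_model.comp (f := fun x : Euc k × ℝ × (Fin k → Euc k) =>
    (x.1, x.2.1, cone x.2.2)) (ContDiff.contDiffOn ?_) fun x hx => hx
  exact contDiff_fst.prodMk ((contDiff_fst.comp contDiff_snd).prodMk
    (contDiff_cone.comp (contDiff_snd.comp contDiff_snd)))

/-- The position of the first point. -/
def base (z : AmbientVec k (k + 1)) : Euc k := z.1 0

theorem contDiff_base {m : WithTop ℕ∞} : ContDiff ℝ m (base (k := k)) := by
  unfold base
  fun_prop

theorem base_model_cone (v : Euc k) (t : ℝ) (B : Fin k → Euc k) : base (model v t (cone B)) = v := by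
  simp [base, model]

variable [NeZero k]

/-- The pair `(i + 1, 0)`. -/
def edgePair (i : Fin k) : Pairs (k + 1) := ⟨(i.succ, 0), Fin.succ_ne_zero i⟩

/-- The triple `(0, i + 1, 1)`. -/
def edgeTriple (i : Fin k) (hi : i ≠ 0) : Triples (k + 1) :=
  ⟨(0, i.succ, (0 : Fin k).succ), (Fin.succ_ne_zero i).symm,
    fun h => hi (Fin.succ_injective _ h), (Fin.succ_ne_zero (0 : Fin k)).symm⟩

/-- The signed distance of the first two points. -/
def scale (z : AmbientVec k (k + 1)) : ℝ :=
  inner ℝ (z.1 (0 : Fin k).succ - z.1 0) (z.2.1 (edgePair 0))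

/-- The edge vectors at the first point, rescaled so that the first one has length `1`. -/
def edges (z : AmbientVec k (k + 1)) : Fin k → Euc k := fun i =>
  if hi : i = 0 then z.2.1 (edgePair i)
  else (z.2.2 (edgeTriple i hi) / (1 - z.2.2 (edgeTriple i hi))) • z.2.1 (edgePair i)

/-- Pairing with the direction, in place of taking a norm, makes the scale polynomial and so smooth
across collisions. -/
theorem contDiff_scale {m : WithTop ℕ∞} : ContDiff ℝ m (scale (k := k)) := by
  unfold scale
  exact ContDiff.inner ℝ (by fun_prop) (by fun_prop)

/-- The coordinate of a ratio `r` is `x = r / (1 + r)`, so `x / (1 - x)` recovers `r`, smoothly as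
long as `x < 1`. -/
theorem contDiffOn_edges {m : WithTop ℕ∞} :
    ContDiffOn ℝ m (edges (k := k)) (finiteRatios k (k + 1)) := by
  refine contDiffOn_pi.2 fun i => ?_
  unfold edges
  split_ifs with hi
  · fun_prop
  · have h : ContDiff ℝ m fun z : AmbientVec k (k + 1) => z.2.2 (edgeTriple i hi) := by fun_prop
    refine ContDiffOn.smul (h.contDiffOn.div (contDiff_const.sub h).contDiffOn fun z hz => ?_)
      (by fun_prop)
    exact (sub_pos.2 (hz _).2).ne'

variable {B : Fin k → Euc k}

theorem scale_model_cone (v : Euc k) (t : ℝ) (hB : ‖B 0‖ = 1) :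
    scale (model v t (cone B)) = t := by
  simp only [scale, model, edgePair, cone_zero, cone_succ, sub_zero, hB, smul_zero, add_zero,
    add_sub_cancel_left, inv_one, one_smul, real_inner_smul_left, real_inner_self_eq_norm_sq]
  ring

theorem edges_model_cone (v : Euc k) (t : ℝ) (hB : ‖B 0‖ = 1)
    (hinj : Function.Injective (cone B)) : edges (model v t (cone B)) = B := by
  funext i
  by_cases hi : i = 0
  · subst hi
    simp only [edges, dite_true, model, edgePair, cone_zero, cone_succ, sub_zero, hB, inv_one,
      one_smul]
  · have hpos : 0 < ‖B i‖ := by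
      simpa using Config.norm_sub_pos ⟨cone B, hinj⟩ (Fin.succ_ne_zero i)
    simp only [edges, hi, dite_false, model, edgePair, edgeTriple, cone_zero, cone_succ, zero_sub,
      norm_neg, hB, sub_zero, smul_smul]
    rw [show ‖B i‖ / (‖B i‖ + 1) / (1 - ‖B i‖ / (‖B i‖ + 1)) * ‖B i‖⁻¹ = 1 by
      have : 1 - ‖B i‖ / (‖B i‖ + 1) = 1 / (‖B i‖ + 1) := by field_simp; ring
      rw [this]; field_simp, one_smul]

/-- Every configuration is, in coordinates, a model configuration with positive scale. -/
theorem exists_ambientCoord_alpha_eq_model (p : Config k (k + 1)) :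
    ∃ (v : Euc k) (t : ℝ) (B : Fin k → Euc k), 0 < t ∧ ‖B 0‖ = 1 ∧ Function.Injective (cone B) ∧
      ambientCoord (alpha p) = model v t (cone B) := by
  set t := ‖p.1 (0 : Fin k).succ - p.1 0‖ with ht
  have htpos : 0 < t := p.norm_sub_pos (Fin.succ_ne_zero _)
  let B : Fin k → Euc k := fun i => t⁻¹ • (p.1 i.succ - p.1 0)
  have hcone : cone B = fun i => t⁻¹ • (p.1 i - p.1 0) := by
    funext i
    refine Fin.cases ?_ (fun j => ?_) i
    · simp
    · simp [B]
  have hinj : Function.Injective (cone B) := by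
    rw [hcone]
    exact fun i j h => p.2 (sub_left_injective (smul_right_injective _ (inv_ne_zero htpos.ne') h))
  have hp : p = Config.affine (p.1 0) htpos ⟨cone B, hinj⟩ := by
    refine Subtype.ext (funext fun i => ?_)
    simp only [Config.affine, hcone]
    rw [smul_inv_smul₀ htpos.ne', add_sub_cancel]
  refine ⟨p.1 0, t, B, htpos, ?_, hinj, ?_⟩
  · simp only [B, norm_smul, norm_inv, norm_norm, ht]
    exact inv_mul_cancel₀ htpos.ne'
  · rw [hp, alpha_affine, ambientCoord_modelPoint, ← hp]

theorem continuous_ambientCoord {k n : ℕ} : Continuous (ambientCoord (k := k) (n := n)) := by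
  unfold ambientCoord
  refine continuous_fst.prodMk (Continuous.prodMk ?_ ?_)
  · fun_prop
  · refine continuous_pi fun s => continuous_subtype_val.comp
      (ENNReal.orderIsoUnitIntervalBirational.toHomeomorph.continuous.comp ?_)
    fun_prop

theorem ambientCoord_mem_finiteRatios (p : Config k (k + 1)) :
    ambientCoord (alpha p) ∈ finiteRatios k (k + 1) := by
  obtain ⟨v, t, B, -, -, hinj, h⟩ := exists_ambientCoord_alpha_eq_model p
  exact h ▸ model_mem_finiteRatios v t hinj

/-- The part of the compactified configuration space where no ratio of distances degenerates
consists of model configurations. -/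
theorem eq_model_of_mem {z : AmbientVec k (k + 1)}
    (hz : z ∈ ambientCoord '' compactConfig k (k + 1)) (hz' : z ∈ finiteRatios k (k + 1)) :
    0 ≤ scale z ∧ ‖edges z 0‖ = 1 ∧ Function.Injective (cone (edges z)) ∧
      model (base z) (scale z) (cone (edges z)) = z := by
  have hcl : z ∈ closure (Set.range fun p : Config k (k + 1) => ambientCoord (alpha p)) := by
    obtain ⟨w, hw, rfl⟩ := hz
    have := image_closure_subset_closure_image continuous_ambientCoord ⟨w, hw, rfl⟩
    rwa [← Set.range_comp] at this
  -- The relations defining a model point, cleared of denominators so that they are closed. The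
  -- frame is a separate variable because `edges` is continuous only where ratios are finite.
  let T : Set ((Fin k → Euc k) × AmbientVec k (k + 1)) := {x | 0 ≤ scale x.2 ∧ ‖x.1 0‖ = 1 ∧
    (∀ i, base x.2 + scale x.2 • cone x.1 i = x.2.1 i) ∧
    (∀ a : Pairs (k + 1), cone x.1 a.1.1 - cone x.1 a.1.2 =
      ‖cone x.1 a.1.1 - cone x.1 a.1.2‖ • x.2.2.1 a) ∧
    ∀ s : Triples (k + 1), ‖cone x.1 s.1.1 - cone x.1 s.1.2.1‖ = x.2.2.2 s *
      (‖cone x.1 s.1.1 - cone x.1 s.1.2.1‖ + ‖cone x.1 s.1.1 - cone x.1 s.1.2.2‖)}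
  have hcs := (contDiff_scale (k := k) (m := 0)).continuous
  have hcb := (contDiff_base (k := k) (m := 0)).continuous
  have hcc : ∀ i, Continuous fun B : Fin k → Euc k => cone B i := fun i =>
    (continuous_apply i).comp (contDiff_cone (k := k) (m := 0)).continuous
  have hT : IsClosed T := by
    simp only [T, Set.ofPred_and, Set.ofPred_forall]
    refine (isClosed_le continuous_const (by fun_prop)).inter
      ((isClosed_eq (by fun_prop) continuous_const).inter
      ((isClosed_iInter fun i => isClosed_eq (by fun_prop) (by fun_prop)).inter
      ((isClosed_iInter fun a => isClosed_eq (by fun_prop) (by fun_prop)).inter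
      (isClosed_iInter fun s => isClosed_eq (by fun_prop) (by fun_prop)))))
  have hmem : (edges z, z) ∈ T := by
    rw [← hT.closure_eq]
    have hcont : ContinuousAt (fun z : AmbientVec k (k + 1) => (edges z, z)) z :=
      ((contDiffOn_edges (m := 0)).continuousOn.continuousAt
        (isOpen_finiteRatios.mem_nhds hz')).prodMk continuousAt_id
    refine hcont.continuousWithinAt.mem_closure hcl ?_
    rintro _ ⟨p, rfl⟩
    obtain ⟨v, t, B, ht, hB, hinj, h⟩ := exists_ambientCoord_alpha_eq_model p
    have hpos : ∀ i j, i ≠ j → 0 < ‖cone B i - cone B j‖ := fun i j hij =>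
      Config.norm_sub_pos ⟨cone B, hinj⟩ hij
    simp only [h, T, Set.mem_ofPred_eq, edges_model_cone v t hB hinj, scale_model_cone v t hB,
      base_model_cone]
    refine ⟨ht.le, hB, fun i => rfl, fun a => ?_, fun s => ?_⟩
    · simp only [model]
      rw [smul_inv_smul₀ (hpos _ _ a.2).ne']
    · simp only [model]
      rw [div_mul_cancel₀ _ (add_pos (hpos _ _ s.2.1) (hpos _ _ s.2.2.2)).ne']
  obtain ⟨h₁, h₂, h₃, h₄, h₅⟩ := hmem
  dsimp only at h₁ h₂ h₃ h₄ h₅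
  -- Cleared relations allow zero lengths in the limit. These are excluded by `‖B i‖ = x (‖B i‖ +
  -- 1)` and then `‖B i - B j‖ = x' (‖B i - B j‖ + ‖B i‖)`, with `x, x' > 0`.
  have h0 : ∀ i : Fin k, 0 < ‖edges z i‖ := by
    intro i
    by_cases hi : i = 0
    · rw [hi, h₂]
      exact one_pos
    · have h := h₅ (edgeTriple i hi)
      simp only [edgeTriple, cone_zero, cone_succ, zero_sub, norm_neg, h₂] at h
      have := (hz' (edgeTriple i hi)).1
      simp only [edgeTriple] at this
      rw [h]
      positivity
  have hpos : ∀ i j, i ≠ j → 0 < ‖cone (edges z) i - cone (edges z) j‖ := by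
    intro i j hij
    rcases eq_or_ne i 0 with rfl | hi
    · obtain ⟨j, rfl⟩ := Fin.exists_succ_eq.2 hij.symm
      simpa using h0 j
    · obtain ⟨i, rfl⟩ := Fin.exists_succ_eq.2 hi
      rcases eq_or_ne j 0 with rfl | hj
      · simpa using h0 i
      · have h := h₅ ⟨(i.succ, j, 0), hij, hj, hi⟩
        have hr := (hz' ⟨(i.succ, j, 0), hij, hj, hi⟩).1
        have hi0 := h0 i
        simp only [cone_zero, cone_succ, sub_zero] at h
        simp only [cone_succ]
        rw [h]
        positivity
  refine ⟨h₁, h₂, fun i j e => by_contra fun hij => (hpos i j hij).ne' (by simp [e]), ?_⟩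
  refine Prod.ext (funext h₃) (Prod.ext (funext fun a => ?_) (funext fun s => ?_))
  · simp only [model]
    rw [inv_smul_eq_iff₀ (hpos _ _ a.2).ne']
    exact h₄ a
  · simp only [model]
    rw [div_eq_iff (add_pos (hpos _ _ s.2.1) (hpos _ _ s.2.2.2)).ne']
    exact h₅ s

end Edges

/-! ### Similar simplices in the collision chart -/

section Similar

variable {k : ℕ}

theorem norm_cone_sub_eq {B B' : Fin k → Euc k}
    (h : ∀ i j, inner ℝ (B i) (B j) = inner ℝ (B' i) (B' j)) (i j : Fin (k + 1)) :
    ‖cone B i - cone B j‖ = ‖cone B' i - cone B' j‖ := by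
  have hc : ∀ i j, inner ℝ (cone B i) (cone B j) = inner ℝ (cone B' i) (cone B' j) := by
    intro i j
    refine Fin.cases (by simp) (fun i => ?_) i
    refine Fin.cases (by simp) (fun j => ?_) j
    exact h i j
  rw [← sq_eq_sq₀ (norm_nonneg _) (norm_nonneg _)]
  simp only [← real_inner_self_eq_norm_sq, inner_sub_left, inner_sub_right, hc]

/-- The coordinates of the simplex `Δ`. -/
def simplexCoord (Δ : Affine.Simplex ℝ (Euc k) k) : AmbientVec k (k + 1) :=
  ambientCoord (alpha (simplexConfig Δ))

theorem simplexCoord_mem_compactConfig (Δ : Affine.Simplex ℝ (Euc k) k) :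
    simplexCoord Δ ∈ ambientCoord '' compactConfig k (k + 1) :=
  ⟨_, subset_closure ⟨_, rfl⟩, rfl⟩

theorem simClosure_subset (Δ : Affine.Simplex ℝ (Euc k) k) :
    ambientCoord '' simClosure Δ ⊆ ambientCoord '' compactConfig k (k + 1) :=
  Set.image_mono (closure_mono (Set.image_subset_range _ _))

variable [NeZero k]

/-- For normalized configurations the ratios of distances determine the Gram matrix, and conversely.
-/
theorem model_ratios_eq_iff {B B' : Fin k → Euc k} (hB : ‖B 0‖ = 1) (hB' : ‖B' 0‖ = 1)
    (hinj : Function.Injective (cone B)) (hinj' : Function.Injective (cone B'))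
    (v v' : Euc k) (t t' : ℝ) :
    (model v t (cone B)).2.2 = (model v' t' (cone B')).2.2 ↔
      ∀ i j, inner ℝ (B i) (B j) = inner ℝ (B' i) (B' j) := by
  refine ⟨fun h => ?_, fun h => ?_⟩
  · have key : ∀ s : Triples (k + 1),
        ‖cone B s.1.1 - cone B s.1.2.1‖ * ‖cone B' s.1.1 - cone B' s.1.2.2‖ =
          ‖cone B' s.1.1 - cone B' s.1.2.1‖ * ‖cone B s.1.1 - cone B s.1.2.2‖ := by
      intro s
      have h₁ := Config.norm_sub_pos ⟨cone B, hinj⟩ s.2.1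
      have h₂ := Config.norm_sub_pos ⟨cone B, hinj⟩ s.2.2.2
      have h₃ := Config.norm_sub_pos ⟨cone B', hinj'⟩ s.2.1
      have h₄ := Config.norm_sub_pos ⟨cone B', hinj'⟩ s.2.2.2
      have hs := congrFun h s
      simp only [model] at hs
      rw [div_eq_div_iff (add_pos h₁ h₂).ne' (add_pos h₃ h₄).ne'] at hs
      linarith
    have hnorm : ∀ i, ‖B i‖ = ‖B' i‖ := by
      intro i
      by_cases hi : i = 0
      · rw [hi, hB, hB']
      · have := key (edgeTriple i hi)
        simpa only [edgeTriple, cone_zero, cone_succ, zero_sub, norm_neg, hB, hB', mul_one]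
          using this
    -- With edge lengths known, the ratio at vertex `i + 1` towards `j + 1` and `0` gives the
    -- remaining distances; polarization then gives inner products.
    have hdist : ∀ i j, ‖B i - B j‖ = ‖B' i - B' j‖ := by
      intro i j
      by_cases hij : i = j
      · simp [hij]
      · have h₁ := key ⟨(i.succ, j.succ, 0), fun h => hij (Fin.succ_injective _ h),
          Fin.succ_ne_zero _, Fin.succ_ne_zero _⟩
        simp only [cone_zero, cone_succ, sub_zero, hnorm] at h₁
        have h₂ : 0 < ‖B' i‖ := by
          simpa using Config.norm_sub_pos ⟨cone B', hinj'⟩ (Fin.succ_ne_zero i)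
        exact mul_right_cancel₀ h₂.ne' h₁
    intro i j
    rw [real_inner_eq_norm_mul_self_add_norm_mul_self_sub_norm_sub_mul_self_div_two,
      real_inner_eq_norm_mul_self_add_norm_mul_self_sub_norm_sub_mul_self_div_two, hnorm, hnorm,
      hdist]
  · funext s
    simp only [model, norm_cone_sub_eq h]

variable (Δ : Affine.Simplex ℝ (Euc k) k)

theorem simplexCoord_mem_finiteRatios : simplexCoord Δ ∈ finiteRatios k (k + 1) :=
  ambientCoord_mem_finiteRatios _

/-- Fixed ratios are a closed condition, which gives one direction. Conversely, the ratios of `Δ`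
are finite and nonzero, so the point is a model point whose shape lies in `Sim Δ`, hence a limit of
similar simplices. -/
theorem mem_simClosure_iff_ratios {z : AmbientVec k (k + 1)} :
    z ∈ ambientCoord '' simClosure Δ ↔
      z ∈ ambientCoord '' compactConfig k (k + 1) ∧ z.2.2 = (simplexCoord Δ).2.2 := by
  refine ⟨fun h => ⟨simClosure_subset Δ h, ?_⟩, fun ⟨h, hr⟩ => ?_⟩
  · obtain ⟨w, hw, rfl⟩ := h
    have hcl : IsClosed {w : Ambient k (k + 1) | w.2.2 = ratio (simplexConfig Δ)} :=
      isClosed_eq (by fun_prop) continuous_const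
    have : w.2.2 = ratio (simplexConfig Δ) :=
      closure_minimal (by rintro _ ⟨q, hq, rfl⟩; exact funext hq) hcl hw
    simp only [ambientCoord, this, simplexCoord, alpha]
  · have hz' : z ∈ finiteRatios k (k + 1) := fun s => hr ▸ simplexCoord_mem_finiteRatios Δ s
    obtain ⟨ht, -, hinj, hmodel⟩ := eq_model_of_mem h hz'
    rw [← hmodel]
    refine model_mem_simClosure Δ (base z) ht (u := ⟨cone (edges z), hinj⟩) fun s => ?_
    refine ENNReal.orderIsoUnitIntervalBirational.injective (Subtype.ext ?_)
    have h₁ : ambientCoord (modelPoint (base z) (scale z) ⟨cone (edges z), hinj⟩) = z := by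
      rw [ambientCoord_modelPoint, hmodel]
    rw [← h₁] at hr
    exact congrFun hr s

theorem finiteRatios_of_mem_simClosure {z : AmbientVec k (k + 1)}
    (hz : z ∈ ambientCoord '' simClosure Δ) : z ∈ finiteRatios k (k + 1) := fun s =>
  ((mem_simClosure_iff_ratios Δ).1 hz).2 ▸ simplexCoord_mem_finiteRatios Δ s

theorem mem_simClosure_iff_inner {z : AmbientVec k (k + 1)}
    (hz : z ∈ ambientCoord '' compactConfig k (k + 1)) (hz' : z ∈ finiteRatios k (k + 1)) :
    z ∈ ambientCoord '' simClosure Δ ↔ ∀ i j, inner ℝ (edges z i) (edges z j) =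
      inner ℝ (edges (simplexCoord Δ) i) (edges (simplexCoord Δ) j) := by
  obtain ⟨-, hB, hinj, hmodel⟩ := eq_model_of_mem hz hz'
  obtain ⟨-, hB', hinj', hmodel'⟩ := eq_model_of_mem (simplexCoord_mem_compactConfig Δ)
    (simplexCoord_mem_finiteRatios Δ)
  rw [mem_simClosure_iff_ratios, ← model_ratios_eq_iff hB hB' hinj hinj' (base z)
    (base (simplexCoord Δ)) (scale z) (scale (simplexCoord Δ)), hmodel, hmodel']
  exact and_iff_right hz

/-- Multiplied by the scale, these are the edge vectors of `Δ` at vertex `0`, independent by affine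
independence. -/
theorem linearIndependent_edges_simplexCoord : LinearIndependent ℝ (edges (simplexCoord Δ)) := by
  obtain ⟨-, -, -, hmodel⟩ := eq_model_of_mem (simplexCoord_mem_compactConfig Δ)
    (simplexCoord_mem_finiteRatios Δ)
  have hp : ∀ i, base (simplexCoord Δ) + scale (simplexCoord Δ) • cone (edges (simplexCoord Δ)) i =
      Δ.points i := fun i => congrFun (congrArg Prod.fst hmodel) i
  have hli := (affineIndependent_iff_linearIndependent_vsub ℝ Δ.points 0).1 Δ.independent
  have hli' := hli.comp (fun i : Fin k => (⟨i.succ, Fin.succ_ne_zero i⟩ : {x : Fin (k + 1) // x ≠ 0}))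
    fun i j h => Fin.succ_injective _ (congrArg Subtype.val h)
  refine LinearIndependent.of_comp (LinearMap.lsmul ℝ (Euc k) (scale (simplexCoord Δ))) ?_
  convert! hli' using 1
  funext i
  simp [← hp]

/-- Matrices whose columns are the given vectors. -/
def columnMatrix {k : ℕ} (B : Fin k → Euc k) : Matrix (Fin k) (Fin k) ℝ :=
  Matrix.of fun a i => B i a

/-- The columns of a matrix. -/
def columns {k : ℕ} (M : Matrix (Fin k) (Fin k) ℝ) : Fin k → Euc k :=
  fun i => WithLp.toLp 2 fun a => M a i

theorem columns_columnMatrix {k : ℕ} (B : Fin k → Euc k) : columns (columnMatrix B) = B := rfl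

theorem columnMatrix_columns {k : ℕ} (M : Matrix (Fin k) (Fin k) ℝ) :
    columnMatrix (columns M) = M := rfl

theorem transpose_mul_columnMatrix {k : ℕ} (B : Fin k → Euc k) (i j : Fin k) :
    ((columnMatrix B).transpose * columnMatrix B) i j = inner ℝ (B i) (B j) := by
  simp [Matrix.mul_apply, columnMatrix, PiLp.inner_apply, mul_comm]

theorem transpose_mul_columnMatrix_eq_iff {k : ℕ} {B B' : Fin k → Euc k} :
    (columnMatrix B).transpose * columnMatrix B = (columnMatrix B').transpose * columnMatrix B' ↔
      ∀ i j, inner ℝ (B i) (B j) = inner ℝ (B' i) (B' j) := by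
  simp only [← transpose_mul_columnMatrix, ← Matrix.ext_iff]

theorem isUnit_columnMatrix {k : ℕ} {B : Fin k → Euc k} (hB : LinearIndependent ℝ B) :
    IsUnit (columnMatrix B) := by
  rw [← Matrix.linearIndependent_cols_iff_isUnit]
  exact hB.map' (WithLp.linearEquiv 2 ℝ (Fin k → ℝ)).toLinearMap (LinearEquiv.ker _)

end Similar

/-! ### The global diffeomorphism and the submanifold charts. -/

section Main

variable {k : ℕ} [NeZero k] (Δ : Affine.Simplex ℝ (Euc k) k)

/-- If `E` and `M` are the column matrices of a frame and of the frame of `Δ`, then `EᵀE = MᵀM`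
exactly when `E * M⁻¹` is orthogonal. This matrix, the scale and the base point are the coordinates.
-/
theorem nonempty_setDiffeo_simClosure :
    Nonempty (SetDiffeo (ambientCoord '' simClosure Δ)
      (orthogonalMatrices k ×ˢ (Set.Ici (0 : ℝ) ×ˢ (Set.univ : Set (Euc k))))) := by
  set BΔ := edges (simplexCoord Δ)
  set M := columnMatrix BΔ
  have hMu : IsUnit M.det := (Matrix.isUnit_iff_isUnit_det _).1
    (isUnit_columnMatrix (linearIndependent_edges_simplexCoord Δ))
  obtain ⟨-, hBΔ0, -, -⟩ := eq_model_of_mem (simplexCoord_mem_compactConfig Δ)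
    (simplexCoord_mem_finiteRatios Δ)
  let f : AmbientVec k (k + 1) → (Fin k → Fin k → ℝ) × ℝ × Euc k := fun z =>
    (fun a b => (columnMatrix (edges z) * M⁻¹) a b, scale z, base z)
  let C : (Fin k → Fin k → ℝ) → Fin k → Euc k := fun A => columns (Matrix.of A * M)
  let g : (Fin k → Fin k → ℝ) × ℝ × Euc k → AmbientVec k (k + 1) := fun y =>
    model y.2.2 y.2.1 (cone (C y.1))
  have hC : ContDiff ℝ ∞ C := by
    refine contDiff_pi.2 fun i => contDiff_euclidean.2 fun a => ?_
    simp only [C, columns, Matrix.mul_apply, Matrix.of_apply]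
    fun_prop
  have hinner : ∀ A ∈ orthogonalMatrices k, ∀ i j,
      inner ℝ (C A i) (C A j) = inner ℝ (BΔ i) (BΔ j) := by
    intro A hA
    rw [← transpose_mul_columnMatrix_eq_iff, columnMatrix_columns, Matrix.transpose_mul,
      Matrix.mul_assoc, ← Matrix.mul_assoc (Matrix.of A).transpose]
    have : (Matrix.of A).transpose * Matrix.of A = 1 := (Matrix.mem_orthogonalGroup_iff' _ _).1 hA
    rw [this, Matrix.one_mul]
  have hinj : ∀ A ∈ orthogonalMatrices k, Function.Injective (cone (C A)) := fun A hA =>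
    cone_injective_of_linearIndependent
      (linearIndependent_of_inner_eq (linearIndependent_edges_simplexCoord Δ) (hinner A hA))
  have hnorm : ∀ A ∈ orthogonalMatrices k, ‖C A 0‖ = 1 := by
    intro A hA
    rw [← hBΔ0, ← sq_eq_sq₀ (norm_nonneg _) (norm_nonneg _), ← real_inner_self_eq_norm_sq,
      ← real_inner_self_eq_norm_sq, hinner A hA]
  refine ⟨SetDiffeo.ofMaps f g (U := finiteRatios k (k + 1))
    (V := {y | Function.Injective (cone (C y.1))}) isOpen_finiteRatios
    (fun z => finiteRatios_of_mem_simClosure Δ) ?_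
    (isOpen_injective_cone.preimage (hC.continuous.comp continuous_fst))
    (fun y hy => hinj _ hy.1) ?_ ?_ ?_ ?_ ?_⟩
  · refine ContDiffOn.prodMk ?_ (contDiff_scale.prodMk contDiff_base).contDiffOn
    refine contDiffOn_pi.2 fun a => contDiffOn_pi.2 fun b => ?_
    simp only [Matrix.mul_apply, columnMatrix, Matrix.of_apply]
    refine ContDiffOn.sum fun i _ => ContDiffOn.mul ?_ contDiffOn_const
    exact contDiffOn_euclidean.1 (contDiffOn_pi.1 contDiffOn_edges i) a
  · refine contDiffOn_model_cone.comp (f := fun y : (Fin k → Fin k → ℝ) × ℝ × Euc k =>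
      (y.2.2, y.2.1, C y.1)) (ContDiff.contDiffOn ?_) fun y hy => hy
    exact (contDiff_snd.comp contDiff_snd).prodMk
      ((contDiff_fst.comp contDiff_snd).prodMk (hC.comp contDiff_fst))
  · intro z hz
    have hz' := finiteRatios_of_mem_simClosure Δ hz
    have hzX := simClosure_subset Δ hz
    refine ⟨?_, (eq_model_of_mem hzX hz').1, trivial⟩
    have h := (mem_simClosure_iff_inner Δ hzX hz').1 hz
    rw [← transpose_mul_columnMatrix_eq_iff] at h
    refine (Matrix.mem_orthogonalGroup_iff' _ _).2 ?_
    change (columnMatrix (edges z) * M⁻¹).transpose * (columnMatrix (edges z) * M⁻¹) = 1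
    rw [Matrix.transpose_mul, Matrix.mul_assoc, ← Matrix.mul_assoc (columnMatrix _).transpose, h,
      Matrix.mul_assoc, Matrix.mul_nonsing_inv _ hMu, Matrix.mul_one, ← Matrix.transpose_mul,
      Matrix.mul_nonsing_inv _ hMu, Matrix.transpose_one]
  · rintro ⟨A, t, v⟩ ⟨hA, ht, -⟩
    have hX : model v t (cone (C A)) ∈ _ := model_mem_compactConfig v ht (hinj A hA)
    refine (mem_simClosure_iff_inner Δ hX (model_mem_finiteRatios v t (hinj A hA))).2 ?_
    rw [edges_model_cone v t (hnorm A hA) (hinj A hA)]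
    exact hinner A hA
  · intro z hz
    have hz' := finiteRatios_of_mem_simClosure Δ hz
    have hCz : C (fun a b => (columnMatrix (edges z) * M⁻¹) a b) = edges z := by
      change columns (columnMatrix (edges z) * M⁻¹ * M) = edges z
      rw [Matrix.mul_assoc, Matrix.nonsing_inv_mul _ hMu, Matrix.mul_one, columns_columnMatrix]
    simp only [g, f, hCz]
    exact (eq_model_of_mem (simClosure_subset Δ hz) hz').2.2.2
  · rintro ⟨A, t, v⟩ ⟨hA, ht, -⟩
    simp only [f, g, edges_model_cone v t (hnorm A hA) (hinj A hA),
      scale_model_cone v t (hnorm A hA), base_model_cone]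
    refine Prod.ext ?_ rfl
    change (columnMatrix (columns (Matrix.of A * M)) * M⁻¹ : Matrix _ _ ℝ) = Matrix.of A
    rw [columnMatrix_columns, Matrix.mul_assoc, Matrix.mul_nonsing_inv _ hMu, Matrix.mul_one]

/-- The chart consists of the base point, the scale and the Gram coordinates centred at the frame of
`x`. Since that frame has the Gram matrix of `Δ`, the closure is where the lower Gram coordinates
vanish. -/
theorem isSubmanifold_simClosure :
    IsSubmanifold (k * (k + 1)) (k.choose 2 + 1 + k)
      (ambientCoord '' compactConfig k (k + 1)) (ambientCoord '' simClosure Δ) := by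
  refine ⟨simClosure_subset Δ, fun x hx => ?_⟩
  have hxX := simClosure_subset Δ hx
  have hxr := finiteRatios_of_mem_simClosure Δ hx
  obtain ⟨-, hB0, hBinj, -⟩ := eq_model_of_mem hxX hxr
  have hgram := (mem_simClosure_iff_inner Δ hxX hxr).1 hx
  set B₀ := edges x
  obtain ⟨P, Q, σ, hP, hQ, hBP, hPO, hσ, hPQ, hQP⟩ := exists_gramCoord_local_inverse
    (linearIndependent_of_inner_eq (linearIndependent_edges_simplexCoord Δ) hgram)
    isOpen_injective_cone hBinj
  let e : Fin k × Fin (k + 1) ≃ Fin (k * (k + 1)) := finProdFinEquiv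
  -- Column `0` holds the base point and column `j + 1` the Gram coordinates `(·, j)`. Entry `(0,
  -- 0)` vanishes identically by normalization, so its slot is free for the scale.
  let o : Fin (k * (k + 1)) := e (0, (0 : Fin k).succ)
  let c : Fin k × Fin k ↪ Fin (k * (k + 1)) :=
    ⟨fun p => e (p.1, p.2.succ), fun p q h => by
      have := e.injective h
      simp only [Prod.mk.injEq, Fin.succ_inj] at this
      exact Prod.ext this.1 this.2⟩
  let K : Finset (Fin (k * (k + 1))) :=
    ((Finset.univ.filter fun p : Fin k × Fin k => p.2 ≤ p.1).erase (0, 0)).map c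
  let coord : AmbientVec k (k + 1) → Fin k × Fin (k + 1) → ℝ := fun z p =>
    Fin.cases (motive := fun _ => ℝ) (base z p.1)
      (fun j => if p.1 = 0 ∧ j = 0 then scale z else gramCoord B₀ (edges z) p.1 j) p.2
  let f : AmbientVec k (k + 1) → Fin (k * (k + 1)) → ℝ := fun z n => coord z (e.symm n)
  have hf0 : ∀ z i, f z (e (i, 0)) = base z i := fun z i => by simp [f, coord]
  have hfo : ∀ z, f z o = scale z := fun z => by
    simp only [f, o, coord, Equiv.symm_apply_apply, Fin.cases_succ, and_self, if_true]
  have hfs : ∀ z i j, ¬(i = 0 ∧ j = 0) → f z (e (i, j.succ)) = gramCoord B₀ (edges z) i j :=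
    fun z i j h => by
      simp only [f, coord, Equiv.symm_apply_apply, Fin.cases_succ, if_neg h]
  let entries : (Fin (k * (k + 1)) → ℝ) → Fin k → Fin k → ℝ := fun y i j =>
    if i = 0 ∧ j = 0 then 0 else y (e (i, j.succ))
  have hentries : ContDiff ℝ ∞ entries := by
    refine contDiff_pi.2 fun i => contDiff_pi.2 fun j => ?_
    simp only [entries]
    split_ifs
    · exact contDiff_const
    · fun_prop
  let g : (Fin (k * (k + 1)) → ℝ) → AmbientVec k (k + 1) := fun y =>
    model (WithLp.toLp 2 fun i => y (e (i, 0))) (y o) (cone (σ (entries y)))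
  let U : Set (AmbientVec k (k + 1)) := finiteRatios k (k + 1) ∩ edges ⁻¹' P
  -- `entries` reads neither the base slots nor `o`, so the chart restricts only the frame, and `J =
  -- {o}` serves collision and non-collision points alike.
  let W : Set (Fin (k * (k + 1)) → ℝ) := entries ⁻¹' Q
  have hU : IsOpen U :=
    (contDiffOn_edges (m := 0)).continuousOn.isOpen_inter_preimage isOpen_finiteRatios hP
  have hW : IsOpen W := hQ.preimage hentries.continuous
  have hfe : ∀ z ∈ ambientCoord '' compactConfig k (k + 1) ∩ U,
      entries (f z) = gramCoord B₀ (edges z) := by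
    rintro z ⟨hz, hzr, -⟩
    funext i j
    simp only [entries]
    split_ifs with h
    · obtain ⟨rfl, rfl⟩ := h
      simp [gramCoord, (eq_model_of_mem hz hzr).2.1, hB0]
    · exact hfs z i j h
  -- The `0` that `entries` puts at `(0, 0)` forces the reconstructed frame to be normalized.
  have hσ0 : ∀ y ∈ W, ‖σ (entries y) 0‖ = 1 := by
    intro y hy
    have h := congrFun (congrFun (hQP _ hy).2 0) 0
    simp only [gramCoord, le_refl, if_true, entries, and_self, real_inner_self_eq_norm_sq, hB0]
      at h
    rw [← sq_eq_sq₀ (norm_nonneg _) zero_le_one]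
    linarith
  have hσinj : ∀ y ∈ W, Function.Injective (cone (σ (entries y))) := fun y hy =>
    hPO (hQP _ hy).1
  refine ⟨{o}, K, ?_, ?_, U, hU, ⟨hxr, hBP⟩, W, hW, SetDiffeo.ofMaps f g hU Set.inter_subset_right
    ?_ hW Set.inter_subset_right ?_ ?_ ?_ ?_ ?_, ?_⟩
  · rw [Finset.disjoint_singleton_left]
    intro ho
    obtain ⟨p, hp, hpo⟩ := Finset.mem_map.1 ho
    have : p = (0, 0) := c.injective hpo
    simp [this] at hp
  -- There are `(k + 1).choose 2 - 1` equations, the entry `(0, 0)` being dropped.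
  · have h := card_lowerTriangle k
    rw [Finset.card_map, Finset.card_erase_of_mem (by simp), h, Nat.choose_succ_succ' k 1,
      Nat.choose_one_right, one_add_one_eq_two]
    have hk := NeZero.pos k
    have h2 := Nat.choose_two_right k
    have h3 : k * (k - 1) + 2 * k = k * (k + 1) := by
      obtain ⟨m, rfl⟩ := Nat.exists_eq_succ_of_ne_zero hk.ne'
      simp only [Nat.succ_eq_add_one, Nat.add_sub_cancel]
      ring
    have h4 := Nat.even_mul_pred_self k
    rw [even_iff_two_dvd] at h4
    omega
  · refine contDiffOn_pi.2 fun n => ?_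
    obtain ⟨⟨i, j⟩, rfl⟩ := e.surjective n
    refine Fin.cases ?_ (fun j => ?_) j
    · simp only [hf0]
      exact (contDiff_euclidean.1 contDiff_base i).contDiffOn
    · by_cases h : i = 0 ∧ j = 0
      · obtain ⟨rfl, rfl⟩ := h
        exact contDiff_scale.contDiffOn.congr fun z _ => hfo z
      · simp only [hfs _ i j h]
        exact contDiffOn_pi.1 (contDiffOn_pi.1 ((contDiff_gramCoord B₀).comp_contDiffOn
          (contDiffOn_edges.mono Set.inter_subset_left)) i) j
  · refine contDiffOn_model_cone.comp (f := fun y : Fin (k * (k + 1)) → ℝ =>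
      ((WithLp.toLp 2 fun i => y (e (i, 0)) : Euc k), y o, σ (entries y))) ?_ hσinj
    refine ContDiffOn.prodMk ?_ (ContDiffOn.prodMk ?_ ?_)
    · exact (contDiff_euclidean.2 fun i => by simpa using contDiff_apply ℝ ℝ _).contDiffOn
    · exact (contDiff_apply ℝ ℝ o).contDiffOn
    · exact hσ.comp hentries.contDiffOn fun y hy => hy
  · intro z hz
    refine ⟨?_, ?_⟩
    · intro n hn
      rw [Finset.mem_singleton.1 hn, hfo]
      exact (eq_model_of_mem hz.1 hz.2.1).1
    · change entries (f z) ∈ Q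
      rw [hfe z hz]
      exact (hPQ _ hz.2.2).1
  · intro y hy
    refine ⟨model_mem_compactConfig _ (hy.1 o (Finset.mem_singleton_self o)) (hσinj y hy.2),
      model_mem_finiteRatios _ _ (hσinj y hy.2), ?_⟩
    change edges (model _ _ (cone (σ (entries y)))) ∈ P
    rw [edges_model_cone _ _ (hσ0 y hy.2) (hσinj y hy.2)]
    exact (hQP _ hy.2).1
  · intro z hz
    have hb : (WithLp.toLp 2 fun i => f z (e (i, 0)) : Euc k) = base z := by
      ext i
      exact hf0 z i
    simp only [g, hfe z hz, (hPQ _ hz.2.2).2, hfo, hb]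
    exact (eq_model_of_mem hz.1 hz.2.1).2.2.2
  · intro y hy
    funext n
    obtain ⟨⟨i, j⟩, rfl⟩ := e.surjective n
    refine Fin.cases ?_ (fun j => ?_) j
    · rw [hf0]
      simp only [g, base_model_cone]
    · by_cases h : i = 0 ∧ j = 0
      · obtain ⟨rfl, rfl⟩ := h
        exact (hfo _).trans (scale_model_cone _ _ (hσ0 y hy.2))
      · rw [hfs _ i j h]
        simp only [g]
        rw [edges_model_cone _ _ (hσ0 y hy.2) (hσinj y hy.2), (hQP _ hy.2).2]
        simp only [entries, if_neg h]
  · rintro ⟨z, hz⟩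
    rw [mem_simClosure_iff_inner Δ hz.1 hz.2.1]
    change _ ↔ ∀ n ∈ K, f z n = 0
    simp only [← hgram]
    constructor
    · intro h n hn
      obtain ⟨⟨i, j⟩, hp, rfl⟩ := Finset.mem_map.1 hn
      simp only [Finset.mem_erase, ne_eq, Prod.mk.injEq, Finset.mem_filter, Finset.mem_univ,
        true_and] at hp
      exact (hfs z i j hp.1).trans (by simp [gramCoord, hp.2, h])
    · intro h
      -- Symmetry reduces the Gram identity to the lower triangle; its entry `(0, 0)`, absent from
      -- `K`, holds by normalization.
      have hle : ∀ i j, j ≤ i → inner ℝ (edges z i) (edges z j) = inner ℝ (B₀ i) (B₀ j) := by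
        intro i j hij
        by_cases h0 : i = 0 ∧ j = 0
        · rw [h0.1, h0.2, real_inner_self_eq_norm_sq, real_inner_self_eq_norm_sq, hB0,
            (eq_model_of_mem hz.1 hz.2.1).2.1]
        · have hn : c (i, j) ∈ K := Finset.mem_map_of_mem c (by simp [hij, h0])
          have := (hfs z i j h0).symm.trans (h _ hn)
          simp only [gramCoord, if_pos hij] at this
          linarith
      intro i j
      rcases le_total j i with hij | hij
      · exact hle i j hij
      · rw [real_inner_comm, hle j i hij, real_inner_comm]

end Main

end SimplexConfig

end

theorem mainTheorem6 (k : ℕ) (hk : 1 ≤ k)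
    (Δ : Affine.Simplex ℝ (EuclideanSpace ℝ (Fin k)) k) :
    SimplexConfig.IsSubmanifold (k * (k + 1)) (k.choose 2 + 1 + k)
        (SimplexConfig.ambientCoord '' SimplexConfig.compactConfig k (k + 1))
        (SimplexConfig.ambientCoord '' SimplexConfig.simClosure Δ) ∧
      Nonempty (SimplexConfig.SetDiffeo
        (SimplexConfig.ambientCoord '' SimplexConfig.simClosure Δ)
        (SimplexConfig.orthogonalMatrices k ×ˢ
          (Set.Ici (0 : ℝ) ×ˢ (Set.univ : Set (EuclideanSpace ℝ (Fin k)))))) := by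
  have : NeZero k := ⟨by omega⟩
  exact ⟨SimplexConfig.isSubmanifold_simClosure Δ, SimplexConfig.nonempty_setDiffeo_simClosure Δ⟩
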